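/- All rings are commutative with nonzero identity, and ring extensions are unital. Let $R\subseteq T$ be a ring extension, where $R$ is von Neumann regular (for every $a\in R$ there is $x\in R$ with $a=axa$). Call $T$ a minimal ring extension of $R$ if $R\neq T$ and there is no ring $S$ with $R\subsetneq S\subsetneq T$; call a field extension $K\subseteq L$ minimal if $K\ne L$ and there is no field strictly between $K$ and $L$; and let $(R:T)=\{s\in T : sT\subseteq R\}$ be the conductor. Then $T$ is a minimal ring extension of $R$ if and only if there exists a maximal ideal $\mathfrak m$ of $R$ such that one of the following three conditions holds: (i) $\mathfrak m$ is a maximal ideal of $T$ and $T/\mathfrak m$ is a minimal field extension of $R/\mathfrak m$; (ii) there exists $q\in T\setminus R$ such that $T=R[q]$, $q^2-q\in\mathfrak m$, and $\mathfrak m q\subseteq R$; (iii) there exists $q\in T\setminus R$ such that $T=R[q]$, $q^2\in R$, $q^3\in R$, and $\mathfrak m q\subseteq R$. If any of these three conditions holds for a maximal ideal $\mathfrak m$ of $R$, then $\mathfrak m=(R:T)$; in particular $\mathfrak m$ is uniquely determined. Moreover, conditions (i)–(iii) are mutually exclusive. -/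

import Mathlib

namespace MinExt

/-- A commutative ring is von Neumann regular if every `a` can be written as `a * x * a`. -/
def IsVonNeumannRegular (R : Type*) [CommRing R] : Prop :=
  ∀ a : R, ∃ x : R, a = a * x * a

/-- `T` is a minimal ring extension of `R`: `R` embeds in `T` as a proper subring, and there is no
subring strictly between (the image of) `R` and `T`. -/
def IsMinimalRingExtension (R T : Type*) [CommRing R] [CommRing T] [Algebra R T] : Prop :=
  Function.Injective (algebraMap R T) ∧ IsCoatom (algebraMap R T).range

/-- `f : K → L` is a minimal field extension: `K` and `L` are fields, `f` is not onto, and no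
subfield of `L` lies strictly between the image of `K` and `L`. -/
def IsMinimalFieldExtension {K L : Type*} [CommRing K] [CommRing L] (f : K →+* L) : Prop :=
  IsField K ∧ IsField L ∧ f.range ≠ ⊤ ∧
    ∀ S : Subring L, IsField S → f.range ≤ S → S = f.range ∨ S = ⊤

/-- The conductor `(R : T) = {s ∈ T | s T ⊆ R}`, an ideal of `T`. -/
def conductor (R T : Type*) [CommRing R] [CommRing T] [Algebra R T] : Ideal T where
  carrier := {s | ∀ t : T, s * t ∈ (algebraMap R T).range}
  add_mem' := fun ha hb t => by
    rw [add_mul]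
    exact add_mem (ha t) (hb t)
  zero_mem' := fun t => by
    rw [zero_mul]
    exact zero_mem _
  smul_mem' := fun c x hx t => by
    have h : c • x * t = x * (c * t) := by
      rw [smul_eq_mul]
      ring
    rw [h]
    exact hx (c * t)

section Cases

variable (R T : Type*) [CommRing R] [CommRing T] [Algebra R T] (m : Ideal R)

theorem le_comap_of_coe_eq_image {R T : Type*} [CommRing R] [CommRing T] [Algebra R T]
    {m : Ideal R} {M : Ideal T} (h : (M : Set T) = algebraMap R T '' (m : Set R)) :
    m ≤ M.comap (algebraMap R T) := fun a ha => by
  rw [Ideal.mem_comap, ← SetLike.mem_coe, h]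
  exact ⟨a, ha, rfl⟩

/-- The subset `m` of `T` is a maximal ideal of `T`, and the canonical map `R/m → T/m` is a minimal
field extension. -/
def CaseField : Prop :=
  ∃ (M : Ideal T) (h : (M : Set T) = algebraMap R T '' (m : Set R)),
    M.IsMaximal ∧
      IsMinimalFieldExtension (Ideal.quotientMap M (algebraMap R T) (le_comap_of_coe_eq_image h))

/-- There is `q ∈ T \ R` with `T = R[q]`, `q² - q ∈ m` and `m q ⊆ R`. -/
def CaseIdempotent : Prop :=
  ∃ q : T, q ∉ (algebraMap R T).range ∧ Algebra.adjoin R {q} = ⊤ ∧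
    q ^ 2 - q ∈ algebraMap R T '' (m : Set R) ∧
    ∀ a ∈ m, algebraMap R T a * q ∈ (algebraMap R T).range

/-- There is `q ∈ T \ R` with `T = R[q]`, `q² ∈ R`, `q³ ∈ R` and `m q ⊆ R`. -/
def CaseNilpotent : Prop :=
  ∃ q : T, q ∉ (algebraMap R T).range ∧ Algebra.adjoin R {q} = ⊤ ∧
    q ^ 2 ∈ (algebraMap R T).range ∧ q ^ 3 ∈ (algebraMap R T).range ∧
    ∀ a ∈ m, algebraMap R T a * q ∈ (algebraMap R T).range

end Cases

end MinExt

/-!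
Let `R` be a maximal subring of `T`, with conductor `C`. For every ideal `J` of `T`, the subring
`R + J` is `R` or `T`, so that either `J ⊆ C` or `R + J = T`. For principal ideals `J` this shows
that `C` is a prime ideal of `R`: if `a b ∈ C` and `a ∉ C`, then `b T = b R + b a T ⊆ R`. It is
maximal in `R` as soon as `R` has Krull dimension zero, as von Neumann regular rings do.

The three cases are told apart by `C` as an ideal of `T`: it is maximal in the first, radical but
not prime in the second, and not radical in the third. If `t ^ 2 ∈ C` and `t ∉ C`, then `q = t` is
as in the third case. If `C` is radical and `t ∉ C` lies in a maximal ideal containing `C`, then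
`R + t ^ 2 T = T` yields `t - t ^ 2 u ∈ C` for some `u`, and `q = t u` is as in the second case.
-/

namespace MinExt

open Polynomial in
theorem notMem_adjoin_pow_of_transcendental {K L : Type*} [Field K] [Field L] [Algebra K L] {x : L}
    (hx : Transcendental K x) {n : ℕ} (hn : 1 < n) : x ∉ IntermediateField.adjoin K {x ^ n} := by
  rw [IntermediateField.mem_adjoin_simple_iff]
  rintro ⟨r, s, h⟩
  have hx0 : x ≠ 0 := by
    rintro rfl
    exact hx isAlgebraic_zero
  have hs : aeval (x ^ n) s ≠ 0 := by
    intro h0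
    rw [h0, div_zero] at h
    exact hx0 h
  have hs0 : s ≠ 0 := by
    rintro rfl
    exact hs (map_zero _)
  have hpoly : X * expand K n s = expand K n r := by
    apply transcendental_iff_injective.mp hx
    rw [map_mul, aeval_X, expand_aeval, expand_aeval]
    exact (eq_div_iff hs).mp h
  -- The degrees of the two sides are `1` and `0` modulo `n`.
  have hdeg : s.natDegree * n + 1 = r.natDegree * n := by
    rw [← natDegree_expand, ← natDegree_expand, ← hpoly,
      natDegree_X_mul ((expand_ne_zero (by omega)).mpr hs0)]
  have hdvd : n ∣ 1 := (Nat.dvd_add_right (Dvd.intro_left _ rfl)).mp (hdeg ▸ Dvd.intro_left _ rfl)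
  exact hn.ne' (Nat.dvd_one.mp hdvd)

theorem isAlgebraic_of_isSimpleOrder_intermediateField (K L : Type*) [Field K] [Field L]
    [Algebra K L] [IsSimpleOrder (IntermediateField K L)] : Algebra.IsAlgebraic K L := by
  refine ⟨fun x => by_contra fun hx => ?_⟩
  rcases eq_bot_or_eq_top (IntermediateField.adjoin K {x ^ 2}) with h | h
  · obtain ⟨a, ha⟩ := IntermediateField.mem_bot.mp
      (IntermediateField.adjoin_simple_eq_bot_iff.mp h)
    exact hx (IsAlgebraic.of_pow two_pos (ha ▸ isAlgebraic_algebraMap a))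
  · exact notMem_adjoin_pow_of_transcendental hx one_lt_two (h ▸ IntermediateField.mem_top)

theorem isCoatom_range_algebraMap_iff {R T : Type*} [CommRing R] [CommRing T] [Algebra R T] :
    IsCoatom (algebraMap R T).range ↔ IsSimpleOrder (Subalgebra R T) := by
  have hbot : (⊥ : Subalgebra R T).toSubring = (algebraMap R T).range :=
    SetLike.ext fun _ => Algebra.mem_bot
  rw [isSimpleOrder_iff_isCoatom_bot, ← hbot]
  constructor
  · refine fun h => ⟨fun htop => h.1 (by rw [htop, Algebra.top_toSubring]), fun A hA => ?_⟩
    exact Algebra.toSubring_eq_top.mp (h.2 _ hA)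
  · refine fun h => ⟨fun htop => h.1 (Algebra.toSubring_eq_top.mp htop), fun S hS => ?_⟩
    let A : Subalgebra R T := { S with algebraMap_mem' := fun a => hS.le (hbot ▸ ⟨a, rfl⟩) }
    have hA : A = ⊤ := h.2 A hS
    exact Algebra.toSubring_eq_top.mpr hA

theorem IsMinimalFieldExtension.isCoatom_range {K L : Type*} [CommRing K] [CommRing L] {f : K →+* L}
    (h : IsMinimalFieldExtension f) : IsCoatom f.range := by
  obtain ⟨hK, hL, hne, hmin⟩ := h
  let := hK.toField
  let := hL.toField
  let := f.toAlgebra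
  have hbot : (⊥ : IntermediateField K L).toSubfield.toSubring = f.range :=
    SetLike.ext fun _ => IntermediateField.mem_bot
  have : IsSimpleOrder (IntermediateField K L) := by
    refine isSimpleOrder_iff_isCoatom_bot.mpr ⟨fun htop => hne ?_, fun F hF => ?_⟩
    · rw [← hbot, htop]
      rfl
    · rcases hmin F.toSubfield.toSubring (Field.toIsField F) (hbot ▸ hF.le) with h1 | h1
      · exact absurd (SetLike.ext fun x => SetLike.ext_iff.mp (h1.trans hbot.symm) x : F = ⊥) hF.ne'
      · exact SetLike.ext fun x => SetLike.ext_iff.mp h1 x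
  have := isAlgebraic_of_isSimpleOrder_intermediateField K L
  exact isCoatom_range_algebraMap_iff.mpr
    ((subalgebraEquivIntermediateField (K := K) (L := L)).isSimpleOrder_iff.mpr inferInstance)

theorem isMinimalFieldExtension_iff {K L : Type*} [CommRing K] [CommRing L] {f : K →+* L} :
    IsMinimalFieldExtension f ↔ IsField K ∧ IsField L ∧ IsCoatom f.range :=
  ⟨fun h => ⟨h.1, h.2.1, h.isCoatom_range⟩,
    fun ⟨hK, hL, h⟩ => ⟨hK, hL, h.1, fun _ _ hS => (h.le_iff.mp hS).symm⟩⟩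

section Quotients

variable {A B : Type*} [CommRing A] [CommRing B]

theorem isCoatom_comap_iff_of_surjective {f : A →+* B} (hf : Function.Surjective f)
    {S : Subring B} : IsCoatom (S.comap f) ↔ IsCoatom S := by
  have hmap (U : Subring B) : (U.comap f).map f = U := Subring.map_comap_eq_self_of_surjective hf U
  have hle (U V : Subring B) : U.comap f ≤ V.comap f ↔ U ≤ V := by
    rw [← Subring.map_le_iff_le_comap, hmap]
  have htop (U : Subring B) : U.comap f = ⊤ ↔ U = ⊤ := by
    rw [← top_le_iff, ← top_le_iff, ← hle ⊤ U, Subring.comap_top]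
  simp only [isCoatom_iff_ge_of_le, ne_eq, htop]
  refine and_congr_right fun _ => ⟨fun h U hU hSU => ?_, fun h U hU hSU => ?_⟩
  · exact (hle U S).mp (h (U.comap f) ((htop U).not.mpr hU) ((hle S U).mpr hSU))
  · have hker : f ⁻¹' {0} ⊆ (S.comap f : Set A) := fun x (hx : f x = 0) =>
      show f x ∈ S from hx ▸ S.zero_mem
    have hU' : (U.map f).comap f = U := Subring.comap_map_eq_self (hker.trans hSU)
    rw [← hU', htop] at hU
    rw [← hU', hle] at hSU ⊢
    exact h _ hU hSU

theorem isCoatom_range_quotientMap_iff {f : A →+* B} {I : Ideal A} {J : Ideal B}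
    (hIJ : I ≤ J.comap f) (hJ : ∀ x ∈ J, x ∈ f.range) :
    IsCoatom (Ideal.quotientMap J f hIJ).range ↔ IsCoatom f.range := by
  suffices h : (Ideal.quotientMap J f hIJ).range.comap (Ideal.Quotient.mk J) = f.range by
    rw [← h, isCoatom_comap_iff_of_surjective Ideal.Quotient.mk_surjective]
  ext x
  constructor
  · rintro ⟨y, hy⟩
    obtain ⟨r, rfl⟩ := Ideal.Quotient.mk_surjective y
    rw [Ideal.quotientMap_mk, eq_comm, Ideal.Quotient.eq] at hy
    simpa only [sub_add_cancel] using add_mem (hJ _ hy) ⟨r, rfl⟩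
  · rintro ⟨r, rfl⟩
    exact ⟨Ideal.Quotient.mk I r, Ideal.quotientMap_mk⟩

end Quotients

variable {R T : Type*} [CommRing R] [CommRing T] [Algebra R T] {m : Ideal R}

theorem le_conductor_iff {J : Ideal T} :
    J ≤ conductor R T ↔ ∀ t ∈ J, t ∈ (algebraMap R T).range :=
  ⟨fun h _ ht => by simpa only [mul_one] using h ht 1,
    fun h _ ht s => h _ (J.mul_mem_right s ht)⟩

theorem mem_range_of_mem_conductor {c : T} (hc : c ∈ conductor R T) : c ∈ (algebraMap R T).range :=
  le_conductor_iff.mp le_rfl c hc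

theorem image_comap_conductor :
    algebraMap R T '' ((conductor R T).comap (algebraMap R T) : Set R) = conductor R T :=
  Set.image_preimage_eq_iff.mpr fun _ hc => mem_range_of_mem_conductor hc

theorem conductor_ne_top (h : (algebraMap R T).range ≠ ⊤) : conductor R T ≠ ⊤ := fun htop =>
  h (eq_top_iff.mpr fun _ _ => mem_range_of_mem_conductor (htop ▸ Submodule.mem_top))

theorem comap_conductor_eq (hm : m.IsMaximal) (h : (algebraMap R T).range ≠ ⊤)
    (hle : m ≤ (conductor R T).comap (algebraMap R T)) :
    (conductor R T).comap (algebraMap R T) = m :=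
  (hm.eq_of_le (Ideal.comap_ne_top _ (conductor_ne_top h)) hle).symm

theorem adjoin_singleton_eq_top (h : IsCoatom (algebraMap R T).range) {q : T}
    (hq : q ∉ (algebraMap R T).range) : Algebra.adjoin R {q} = ⊤ := by
  have := isCoatom_range_algebraMap_iff.mp h
  refine (eq_bot_or_eq_top _).resolve_left fun hbot => hq ?_
  exact Algebra.mem_bot.mp (hbot ▸ Algebra.self_mem_adjoin_singleton R q)

theorem le_conductor_or_surjective_algebraMap_quotient (h : IsCoatom (algebraMap R T).range)
    (J : Ideal T) : J ≤ conductor R T ∨ Function.Surjective (algebraMap R (T ⧸ J)) := by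
  have hle : (algebraMap R T).range ≤ (algebraMap R (T ⧸ J)).range.comap (Ideal.Quotient.mk J) := by
    rintro _ ⟨r, rfl⟩
    exact ⟨r, rfl⟩
  rcases h.le_iff.mp hle with h1 | h1
  · refine Or.inr fun x => ?_
    obtain ⟨t, rfl⟩ := Ideal.Quotient.mk_surjective x
    exact Subring.mem_comap.mp (h1 ▸ Subring.mem_top t)
  · refine Or.inl (le_conductor_iff.mpr fun _ ht => h1 ▸ Subring.mem_comap.mpr ?_)
    rw [Ideal.Quotient.eq_zero_iff_mem.mpr ht]
    exact zero_mem _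

theorem exists_eq_add_mul_of_notMem_conductor (h : IsCoatom (algebraMap R T).range) {t : T}
    (ht : t ∉ conductor R T) (x : T) : ∃ (r : R) (u : T), x = algebraMap R T r + t * u := by
  rcases le_conductor_or_surjective_algebraMap_quotient h (Ideal.span {t}) with h1 | h1
  · exact absurd (h1 (Ideal.mem_span_singleton_self t)) ht
  · obtain ⟨r, hr⟩ := h1 (Ideal.Quotient.mk _ x)
    obtain ⟨u, hu⟩ := Ideal.mem_span_singleton.mp (Ideal.Quotient.eq.mp hr.symm)
    exact ⟨r, u, eq_add_of_sub_eq' hu⟩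

theorem isPrime_comap_conductor (h : IsCoatom (algebraMap R T).range) :
    ((conductor R T).comap (algebraMap R T)).IsPrime where
  ne_top' := Ideal.comap_ne_top _ (conductor_ne_top h.1)
  mem_or_mem' {a b} hab := by
    refine or_iff_not_imp_left.mpr fun ha x => ?_
    obtain ⟨r, u, rfl⟩ := exists_eq_add_mul_of_notMem_conductor h ha x
    rw [mul_add, mul_left_comm, ← mul_assoc, ← map_mul, ← map_mul]
    exact add_mem ⟨b * r, rfl⟩ (hab u)

theorem caseField_of_isMaximal_conductor (h : IsCoatom (algebraMap R T).range)
    (hm : ((conductor R T).comap (algebraMap R T)).IsMaximal) (hC : (conductor R T).IsMaximal) :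
    CaseField R T ((conductor R T).comap (algebraMap R T)) :=
  ⟨conductor R T, image_comap_conductor.symm, hC, isMinimalFieldExtension_iff.mpr
    ⟨(Ideal.Quotient.maximal_ideal_iff_isField_quotient _).mp hm,
      (Ideal.Quotient.maximal_ideal_iff_isField_quotient _).mp hC,
      (isCoatom_range_quotientMap_iff _ fun _ => mem_range_of_mem_conductor).mpr h⟩⟩

theorem caseNilpotent_of_not_isRadical_conductor (h : IsCoatom (algebraMap R T).range)
    (hC : ¬ (conductor R T).IsRadical) :
    CaseNilpotent R T ((conductor R T).comap (algebraMap R T)) := by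
  rw [Ideal.isRadical_iff_pow_one_lt 2 one_lt_two] at hC
  push Not at hC
  obtain ⟨t, htsq, ht⟩ := hC
  have htR : t ∉ (algebraMap R T).range := by
    rintro ⟨r, rfl⟩
    rw [← map_pow] at htsq
    exact ht ((isPrime_comap_conductor h).mem_of_pow_mem 2 htsq)
  exact ⟨t, htR, adjoin_singleton_eq_top h htR, mem_range_of_mem_conductor htsq,
    pow_succ t 2 ▸ htsq t, fun _ ha => ha t⟩

theorem caseIdempotent_of_isRadical_conductor (h : IsCoatom (algebraMap R T).range)
    (hm : ((conductor R T).comap (algebraMap R T)).IsMaximal) (hrad : (conductor R T).IsRadical)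
    (hC : ¬ (conductor R T).IsMaximal) :
    CaseIdempotent R T ((conductor R T).comap (algebraMap R T)) := by
  obtain ⟨J, hJ, hCJ⟩ := Ideal.exists_le_maximal _ (conductor_ne_top h.1)
  have hJR (r : R) (hr : algebraMap R T r ∈ J) : algebraMap R T r ∈ conductor R T := by
    rw [← Ideal.mem_comap, hm.eq_of_le (Ideal.comap_ne_top _ hJ.ne_top) (Ideal.comap_mono hCJ)]
    exact hr
  obtain ⟨t, htJ, htC⟩ := SetLike.exists_of_lt (hCJ.lt_of_ne fun h0 => hC (h0 ▸ hJ))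
  obtain ⟨r, u, htu⟩ := exists_eq_add_mul_of_notMem_conductor h
    (fun htsq => htC (hrad ⟨2, htsq⟩) : t ^ 2 ∉ conductor R T) t
  have hC' : t - t ^ 2 * u ∈ conductor R T := by
    have hr : algebraMap R T r = t - t ^ 2 * u := eq_sub_of_add_eq htu.symm
    rw [← hr]
    exact hJR r (hr ▸ sub_mem htJ (J.mul_mem_right u (J.pow_mem_of_mem htJ 2 two_pos)))
  have hq : t * u ∉ (algebraMap R T).range := by
    rintro ⟨s, hs⟩
    have htuC : t * u ∈ conductor R T := hs ▸ hJR s (hs ▸ J.mul_mem_right u htJ)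
    have h2 : t ^ 2 * u ∈ conductor R T := by
      rw [pow_two, mul_assoc]
      exact Ideal.mul_mem_left _ t htuC
    exact htC (by simpa only [sub_add_cancel] using add_mem hC' h2)
  refine ⟨t * u, hq, adjoin_singleton_eq_top h hq, ?_, fun _ ha => ha _⟩
  rw [image_comap_conductor, show (t * u) ^ 2 - t * u = -u * (t - t ^ 2 * u) by ring]
  exact Ideal.mul_mem_left _ _ hC'

theorem cases_of_isCoatom_range (h : IsCoatom (algebraMap R T).range)
    (hm : ((conductor R T).comap (algebraMap R T)).IsMaximal) :
    CaseField R T ((conductor R T).comap (algebraMap R T)) ∨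
      CaseIdempotent R T ((conductor R T).comap (algebraMap R T)) ∨
        CaseNilpotent R T ((conductor R T).comap (algebraMap R T)) := by
  by_cases hC : (conductor R T).IsMaximal
  · exact Or.inl (caseField_of_isMaximal_conductor h hm hC)
  by_cases hrad : (conductor R T).IsRadical
  · exact Or.inr (Or.inl (caseIdempotent_of_isRadical_conductor h hm hrad hC))
  · exact Or.inr (Or.inr (caseNilpotent_of_not_isRadical_conductor h hrad))

/-- The class of `q` generates the `R`-module `T / R`, is nonzero and is killed by `m`; for maximal
`m` this says that `T / R` is a simple module, isomorphic to `R / m`. Both of the cases other than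
`CaseField` yield such a `q`. -/
structure IsSimpleGenerator (m : Ideal R) (q : T) : Prop where
  notMem_range : q ∉ (algebraMap R T).range
  exists_eq_add_mul (t : T) : ∃ a b : R, t = algebraMap R T a + algebraMap R T b * q
  mul_mem_range {a : R} : a ∈ m → algebraMap R T a * q ∈ (algebraMap R T).range

namespace IsSimpleGenerator

variable {q : T}

theorem range_ne_top (h : IsSimpleGenerator m q) : (algebraMap R T).range ≠ ⊤ := fun htop =>
  h.notMem_range (htop ▸ Subring.mem_top q)

theorem mem_of_mul_mem (h : IsSimpleGenerator m q) (hm : m.IsMaximal) {S : Subring T}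
    (hS : (algebraMap R T).range ≤ S) {b : R} (hb : b ∉ m) (hbq : algebraMap R T b * q ∈ S) :
    q ∈ S := by
  obtain ⟨c, a, ha, hca⟩ := hm.exists_inv hb
  have hq : q = algebraMap R T c * (algebraMap R T b * q) + algebraMap R T a * q := by
    rw [← mul_assoc, ← add_mul, ← map_mul, ← map_add, hca, map_one, one_mul]
  rw [hq]
  exact add_mem (mul_mem (hS ⟨c, rfl⟩) hbq) (hS (h.mul_mem_range ha))

theorem add_mul_mem_range_iff (h : IsSimpleGenerator m q) (hm : m.IsMaximal) {a b : R} :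
    algebraMap R T a + algebraMap R T b * q ∈ (algebraMap R T).range ↔ b ∈ m := by
  rw [add_mem_cancel_left (RingHom.mem_range_self _ a)]
  exact ⟨fun hbq => by_contra fun hb => h.notMem_range (h.mem_of_mul_mem hm le_rfl hb hbq),
    h.mul_mem_range⟩

theorem isCoatom_range (h : IsSimpleGenerator m q) (hm : m.IsMaximal) :
    IsCoatom (algebraMap R T).range := by
  refine ⟨h.range_ne_top, fun S hS => eq_top_iff.mpr fun t _ => ?_⟩
  obtain ⟨s, hsS, hs⟩ := SetLike.exists_of_lt hS
  obtain ⟨a, b, rfl⟩ := h.exists_eq_add_mul s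
  rw [h.add_mul_mem_range_iff hm] at hs
  rw [add_mem_cancel_left (hS.le (RingHom.mem_range_self _ a))] at hsS
  obtain ⟨c, d, rfl⟩ := h.exists_eq_add_mul t
  exact add_mem (hS.le ⟨c, rfl⟩) (mul_mem (hS.le ⟨d, rfl⟩) (h.mem_of_mul_mem hm hS.le hs hsS))

theorem le_comap_conductor (h : IsSimpleGenerator m q) :
    m ≤ (conductor R T).comap (algebraMap R T) := by
  intro a ha t
  obtain ⟨c, d, rfl⟩ := h.exists_eq_add_mul t
  rw [mul_add, mul_left_comm]
  exact add_mem (mul_mem ⟨a, rfl⟩ ⟨c, rfl⟩) (mul_mem ⟨d, rfl⟩ (h.mul_mem_range ha))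

theorem mem_of_add_mul_mem_conductor (h : IsSimpleGenerator m q) (hm : m.IsMaximal) {a b : R}
    (hab : algebraMap R T a + algebraMap R T b * q ∈ conductor R T) : a ∈ m ∧ b ∈ m := by
  have hb : b ∈ m := (h.add_mul_mem_range_iff hm).mp (mem_range_of_mem_conductor hab)
  have hbq : algebraMap R T b * q ∈ conductor R T :=
    Ideal.mul_mem_right _ _ (h.le_comap_conductor hb)
  refine ⟨?_, hb⟩
  rw [← comap_conductor_eq hm h.range_ne_top h.le_comap_conductor]
  exact (add_mem_cancel_right hbq).mp hab

theorem isRadical_conductor (h : IsSimpleGenerator m q) (hm : m.IsMaximal)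
    (hq : q ^ 2 - q ∈ conductor R T) : (conductor R T).IsRadical := by
  rw [Ideal.isRadical_iff_pow_one_lt 2 one_lt_two]
  intro t ht
  obtain ⟨a, b, rfl⟩ := h.exists_eq_add_mul t
  have hsq : algebraMap R T (a ^ 2) + algebraMap R T (2 * a * b + b ^ 2) * q ∈ conductor R T := by
    convert! sub_mem ht (Ideal.mul_mem_left _ (algebraMap R T b ^ 2) hq) using 1
    simp only [map_add, map_mul, map_pow, map_ofNat]
    ring
  obtain ⟨ha2, hab⟩ := h.mem_of_add_mul_mem_conductor hm hsq
  have ha : a ∈ m := hm.isPrime.mem_of_pow_mem 2 ha2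
  have hb : b ∈ m := hm.isPrime.mem_of_pow_mem 2
    ((add_mem_cancel_left (m.mul_mem_right b (m.mul_mem_left 2 ha))).mp hab)
  exact add_mem (h.le_comap_conductor ha) (Ideal.mul_mem_right q _ (h.le_comap_conductor hb))

end IsSimpleGenerator

theorem exists_eq_add_mul_of_adjoin_eq_top {q : T} (hq : Algebra.adjoin R {q} = ⊤) {c d : R}
    (hsq : q ^ 2 = algebraMap R T c + algebraMap R T d * q) (t : T) :
    ∃ a b : R, t = algebraMap R T a + algebraMap R T b * q := by
  have ht : t ∈ Algebra.adjoin R {q} := hq ▸ Algebra.mem_top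
  induction ht using Algebra.adjoin_induction with
  | mem x hx => exact ⟨0, 1, by rw [Set.mem_singleton_iff.mp hx, map_zero, map_one]; ring⟩
  | algebraMap r => exact ⟨r, 0, by rw [map_zero]; ring⟩
  | add x y _ _ hx hy =>
    obtain ⟨a, b, rfl⟩ := hx
    obtain ⟨a', b', rfl⟩ := hy
    exact ⟨a + a', b + b', by simp only [map_add]; ring⟩
  | mul x y _ _ hx hy =>
    obtain ⟨a, b, rfl⟩ := hx
    obtain ⟨a', b', rfl⟩ := hy
    refine ⟨a * a' + b * b' * c, a * b' + b * a' + b * b' * d, ?_⟩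
    simp only [map_add, map_mul]
    linear_combination algebraMap R T b * algebraMap R T b' * hsq

theorem CaseIdempotent.exists_isSimpleGenerator (h : CaseIdempotent R T m) :
    ∃ q : T, IsSimpleGenerator m q ∧ q ^ 2 - q ∈ conductor R T := by
  obtain ⟨q, hq, hgen, ⟨c, hcm, hc⟩, hmq⟩ := h
  have hsq : q ^ 2 = algebraMap R T c + algebraMap R T 1 * q := by
    rw [hc, map_one]
    ring
  have hS : IsSimpleGenerator m q := ⟨hq, exists_eq_add_mul_of_adjoin_eq_top hgen hsq, hmq _⟩
  exact ⟨q, hS, hc ▸ hS.le_comap_conductor hcm⟩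

theorem CaseNilpotent.exists_isSimpleGenerator (h : CaseNilpotent R T m) (hm : m.IsMaximal) :
    ∃ q : T, IsSimpleGenerator m q ∧ q ^ 2 ∈ conductor R T := by
  obtain ⟨q, hq, hgen, ⟨c, hc⟩, hcube, hmq⟩ := h
  have hsq : q ^ 2 = algebraMap R T c + algebraMap R T 0 * q := by
    rw [hc, map_zero]
    ring
  have hS : IsSimpleGenerator m q := ⟨hq, exists_eq_add_mul_of_adjoin_eq_top hgen hsq, hmq _⟩
  -- If `q ^ 2 ∉ m`, then `q ^ 2 * q ∈ R` would force `q ∈ R`.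
  have hcm : c ∈ m := by
    by_contra hcm
    exact hq (hS.mem_of_mul_mem hm le_rfl hcm (by rwa [hc, ← pow_succ]))
  exact ⟨q, hS, hc ▸ hS.le_comap_conductor hcm⟩

theorem CaseField.isCoatom_range (h : CaseField R T m) : IsCoatom (algebraMap R T).range := by
  obtain ⟨M, hM, -, hmin⟩ := h
  have hMR : ∀ x ∈ M, x ∈ (algebraMap R T).range := fun x hx =>
    Set.image_subset_range _ _ (hM.subset hx)
  exact (isCoatom_range_quotientMap_iff _ hMR).mp hmin.isCoatom_range

theorem CaseField.le_comap_conductor (h : CaseField R T m) :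
    m ≤ (conductor R T).comap (algebraMap R T) := by
  obtain ⟨M, hM, -⟩ := h
  have hMC : M ≤ conductor R T :=
    le_conductor_iff.mpr fun x hx => Set.image_subset_range _ _ (hM.subset hx)
  exact fun a ha => hMC (le_comap_of_coe_eq_image hM ha)

theorem isCoatom_range_of_cases (hm : m.IsMaximal)
    (h : CaseField R T m ∨ CaseIdempotent R T m ∨ CaseNilpotent R T m) :
    IsCoatom (algebraMap R T).range := by
  rcases h with h | h | h
  · exact h.isCoatom_range
  · obtain ⟨q, hq, -⟩ := h.exists_isSimpleGenerator
    exact hq.isCoatom_range hm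
  · obtain ⟨q, hq, -⟩ := h.exists_isSimpleGenerator hm
    exact hq.isCoatom_range hm

theorem image_eq_conductor_of_cases (hm : m.IsMaximal)
    (h : CaseField R T m ∨ CaseIdempotent R T m ∨ CaseNilpotent R T m) :
    algebraMap R T '' (m : Set R) = (conductor R T : Set T) := by
  have hle : m ≤ (conductor R T).comap (algebraMap R T) := by
    rcases h with h | h | h
    · exact h.le_comap_conductor
    · obtain ⟨q, hq, -⟩ := h.exists_isSimpleGenerator
      exact hq.le_comap_conductor
    · obtain ⟨q, hq, -⟩ := h.exists_isSimpleGenerator hm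
      exact hq.le_comap_conductor
  rw [← comap_conductor_eq hm (isCoatom_range_of_cases hm h).1 hle, image_comap_conductor]

theorem CaseField.isMaximal_conductor (h : CaseField R T m) (hm : m.IsMaximal) :
    (conductor R T).IsMaximal := by
  have hC := image_eq_conductor_of_cases hm (Or.inl h)
  obtain ⟨M, hM, hmax, -⟩ := h
  rwa [← SetLike.coe_injective (hM.trans hC)]

theorem CaseIdempotent.not_isPrime_conductor (h : CaseIdempotent R T m) :
    ¬ (conductor R T).IsPrime := by
  intro hprime
  obtain ⟨q, hS, hq⟩ := h.exists_isSimpleGenerator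
  rw [show q ^ 2 - q = q * (q - 1) by ring] at hq
  rcases hprime.mem_or_mem hq with h1 | h1
  · exact hS.notMem_range (mem_range_of_mem_conductor h1)
  · refine hS.notMem_range ?_
    simpa only [sub_add_cancel] using add_mem (mem_range_of_mem_conductor h1) (one_mem _)

theorem CaseIdempotent.isRadical_conductor (h : CaseIdempotent R T m) (hm : m.IsMaximal) :
    (conductor R T).IsRadical := by
  obtain ⟨q, hS, hq⟩ := h.exists_isSimpleGenerator
  exact hS.isRadical_conductor hm hq

theorem CaseNilpotent.not_isRadical_conductor (h : CaseNilpotent R T m) (hm : m.IsMaximal) :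
    ¬ (conductor R T).IsRadical := by
  obtain ⟨q, hS, hq⟩ := h.exists_isSimpleGenerator hm
  exact fun hrad => hS.notMem_range (mem_range_of_mem_conductor (hrad ⟨2, hq⟩))

theorem IsVonNeumannRegular.krullDimLE_zero (hR : IsVonNeumannRegular R) :
    Ring.KrullDimLE 0 R := by
  refine .mk₀ fun P hP => Ideal.isMaximal_iff.mpr ⟨P.one_notMem, fun J a hPJ ha haJ => ?_⟩
  obtain ⟨x, hx⟩ := hR a
  have hmem : a * (1 - a * x) ∈ P := by
    rw [show a * (1 - a * x) = 0 by linear_combination hx]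
    exact P.zero_mem
  have h1 : 1 - a * x ∈ J := hPJ ((hP.mem_or_mem hmem).resolve_left ha)
  simpa only [sub_add_cancel] using add_mem h1 (J.mul_mem_right x haJ)

end MinExt

theorem theorem2p2_general {R T : Type*} [CommRing R] [CommRing T] [Algebra R T]
    [Ring.KrullDimLE 0 R] (hRT : Function.Injective (algebraMap R T)) :
    (MinExt.IsMinimalRingExtension R T ↔
      ∃ m : Ideal R, m.IsMaximal ∧
        (MinExt.CaseField R T m ∨ MinExt.CaseIdempotent R T m ∨ MinExt.CaseNilpotent R T m)) ∧
    (∀ m : Ideal R, m.IsMaximal →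
      (MinExt.CaseField R T m ∨ MinExt.CaseIdempotent R T m ∨ MinExt.CaseNilpotent R T m) →
        algebraMap R T '' (m : Set R) = (MinExt.conductor R T : Set T)) ∧
    (∀ m : Ideal R, m.IsMaximal →
      ¬ (MinExt.CaseField R T m ∧ MinExt.CaseIdempotent R T m) ∧
      ¬ (MinExt.CaseField R T m ∧ MinExt.CaseNilpotent R T m) ∧
      ¬ (MinExt.CaseIdempotent R T m ∧ MinExt.CaseNilpotent R T m)) := by
  refine ⟨⟨fun h => ?_, fun ⟨m, hm, h⟩ => ⟨hRT, MinExt.isCoatom_range_of_cases hm h⟩⟩,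
    fun m => MinExt.image_eq_conductor_of_cases, fun m hm => ⟨?_, ?_, ?_⟩⟩
  · have hm := (MinExt.isPrime_comap_conductor h.2).isMaximal'
    exact ⟨_, hm, MinExt.cases_of_isCoatom_range h.2 hm⟩
  · exact fun ⟨hF, hI⟩ => hI.not_isPrime_conductor (hF.isMaximal_conductor hm).isPrime
  · exact fun ⟨hF, hN⟩ =>
      hN.not_isRadical_conductor hm (hF.isMaximal_conductor hm).isPrime.isRadical
  · exact fun ⟨hI, hN⟩ => hN.not_isRadical_conductor hm (hI.isRadical_conductor hm)

theorem theorem2p2 {R T : Type*} [CommRing R] [CommRing T] [Algebra R T]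
    (hRT : Function.Injective (algebraMap R T)) (hR : MinExt.IsVonNeumannRegular R) :
    (MinExt.IsMinimalRingExtension R T ↔
      ∃ m : Ideal R, m.IsMaximal ∧
        (MinExt.CaseField R T m ∨ MinExt.CaseIdempotent R T m ∨ MinExt.CaseNilpotent R T m)) ∧
    (∀ m : Ideal R, m.IsMaximal →
      (MinExt.CaseField R T m ∨ MinExt.CaseIdempotent R T m ∨ MinExt.CaseNilpotent R T m) →
        algebraMap R T '' (m : Set R) = (MinExt.conductor R T : Set T)) ∧
    (∀ m : Ideal R, m.IsMaximal →
      ¬ (MinExt.CaseField R T m ∧ MinExt.CaseIdempotent R T m) ∧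
      ¬ (MinExt.CaseField R T m ∧ MinExt.CaseNilpotent R T m) ∧
      ¬ (MinExt.CaseIdempotent R T m ∧ MinExt.CaseNilpotent R T m)) := by
  have := hR.krullDimLE_zero
  exact theorem2p2_general hRT
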